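/- Let $K$ be an algebraically closed field of characteristic $0$. For a Lie algebra $\mathfrak g$ over $K$ put $\mathfrak g^1=\mathfrak g$ and $\mathfrak g^{k+1}=[\mathfrak g,\mathfrak g^k]$ for $k\ge 1$. Let $F_2$ be the free Lie algebra over $K$ on two generators, let $F_{2,c}=F_2/F_2^{c+1}$, and let $$M_{2,c}=F_{2,c}/[F_{2,c}^2,F_{2,c}^2]$$ be the free $c$-step nilpotent and metabelian Lie algebra on two generators. For a finite-dimensional Lie algebra $\mathfrak g$ over $K$ and a linear form $\ell\in\mathfrak g^*$, let $\mathfrak g(\ell)=\{y\in\mathfrak g\mid \ell([x,y])=0\ \text{for all } x\in\mathfrak g\}$. Let $\chi(\mathfrak g)=\inf\{\dim\mathfrak g(\ell)\mid \ell\in\mathfrak g^*\}$ be the index of $\mathfrak g$, and let $\alpha(\mathfrak g)$ be the maximal dimension of an abelian subalgebra of $\mathfrak g$. Theorem 5.4. If $c\ge 4$, then $\mathfrak g=M_{2,c}$ is finite-dimensional and $$\chi(\mathfrak g)=\dim\mathfrak g-4=2\alpha(\mathfrak g)-\dim\mathfrak g=\frac{c^2-c-4}{2}.$$ -/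

import Mathlib

section LieIndex

variable (K L : Type*) [Field K] [LieRing L] [LieAlgebra K L]

/-- The radical `𝔤(ℓ) = {y | ℓ([x, y]) = 0 for all x}` of the skew-symmetric bilinear form
`(x, y) ↦ ℓ([x, y])` attached to a linear form `ℓ` on a Lie algebra. It is a Lie subalgebra. -/
def lieFormRadical (l : Module.Dual K L) : LieSubalgebra K L where
  carrier := {y | ∀ x : L, l ⁅x, y⁆ = 0}
  zero_mem' := by intro x; simp
  add_mem' := by
    intro a b ha hb x
    rw [lie_add, map_add, ha x, hb x, add_zero]
  smul_mem' := by
    intro t a ha x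
    rw [lie_smul, map_smul, ha x, smul_zero]
  lie_mem' := by
    intro a b ha hb x
    have h : l ⁅a, ⁅x, b⁆⁆ = 0 := by
      rw [← lie_skew, map_neg, ha, neg_zero]
    rw [leibniz_lie, map_add, hb, h, add_zero]

/-- The index `χ(𝔤) = inf {dim 𝔤(ℓ) | ℓ ∈ 𝔤*}` of a (finite-dimensional) Lie algebra. -/
noncomputable def lieIndex : ℕ :=
  sInf {d : ℕ | ∃ l : Module.Dual K L, Module.finrank K (lieFormRadical K L l) = d}

/-- The maximal dimension `α(𝔤)` of an abelian subalgebra of a (finite-dimensional)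
Lie algebra. -/
noncomputable def lieAlpha : ℕ :=
  sSup {d : ℕ | ∃ H : LieSubalgebra K L, IsLieAbelian H ∧ Module.finrank K H = d}

/-- The index is attained, so the infimum is a minimum. -/
theorem lieIndex_isLeast :
    IsLeast {d : ℕ | ∃ l : Module.Dual K L, Module.finrank K (lieFormRadical K L l) = d}
      (lieIndex K L) :=
  ⟨Nat.sInf_mem ⟨_, 0, rfl⟩, fun _ hd => Nat.sInf_le hd⟩

/-- For a finite-dimensional Lie algebra, `α` is a genuine maximum. -/
theorem lieAlpha_isGreatest [Module.Finite K L] :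
    IsGreatest {d : ℕ | ∃ H : LieSubalgebra K L, IsLieAbelian H ∧ Module.finrank K H = d}
      (lieAlpha K L) := by
  have hb : BddAbove
      {d : ℕ | ∃ H : LieSubalgebra K L, IsLieAbelian H ∧ Module.finrank K H = d} := by
    refine ⟨Module.finrank K L, ?_⟩
    rintro d ⟨H, -, rfl⟩
    exact Submodule.finrank_le H.toSubmodule
  have hne : Set.Nonempty
      {d : ℕ | ∃ H : LieSubalgebra K L, IsLieAbelian H ∧ Module.finrank K H = d} :=
    ⟨_, ⊥, ⟨fun x y => by
      have hx : (x : L) = 0 := (LieSubalgebra.mem_bot (x : L)).1 x.2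
      apply Subtype.ext
      rw [LieSubalgebra.coe_bracket, hx, zero_lie]
      rfl⟩, rfl⟩
  exact ⟨Nat.sSup_mem hne hb, fun _ hd => le_csSup hb hd⟩

end LieIndex

/-- The free-nilpotent Lie algebra `F_{g,c} = F_g / F_g^{c+1}` with `g` generators and nilpotency
class `c`. The lower central series is indexed from `0` in `LieModule.lowerCentralSeries`, so
its `c`-th term is `F_g^{c+1}` in the convention `F_g^1 = F_g`, `F_g^{k+1} = [F_g, F_g^k]`. -/
abbrev FreeNilpotentLie (K : Type*) [Field K] (g c : ℕ) : Type _ :=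
  FreeLieAlgebra K (Fin g) ⧸
    (LieModule.lowerCentralSeries K (FreeLieAlgebra K (Fin g)) (FreeLieAlgebra K (Fin g)) c :
      LieIdeal K (FreeLieAlgebra K (Fin g)))

/-- The ideal `[𝔤², 𝔤²]`, where `𝔤² = [𝔤, 𝔤]`. -/
abbrev secondDerivedIdeal (K L : Type*) [Field K] [LieRing L] [LieAlgebra K L] : LieIdeal K L :=
  ⁅⁅(⊤ : LieIdeal K L), (⊤ : LieIdeal K L)⁆, ⁅(⊤ : LieIdeal K L), (⊤ : LieIdeal K L)⁆⁆

/-- The free `c`-step nilpotent and metabelian Lie algebra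
`M_{g,c} = F_{g,c} / [F_{g,c}², F_{g,c}²]` with `g` generators. -/
abbrev FreeMetabelianLie (K : Type*) [Field K] (g c : ℕ) : Type _ :=
  FreeNilpotentLie K g c ⧸ secondDerivedIdeal K (FreeNilpotentLie K g c)

/-! Modulo the second derived ideal, `ad x` and `ad y` commute on the derived algebra, so $M_{2,c}$
is the plane $Kx\oplus Ky$ extended by $K[X,Y]$ truncated in degrees $\ge n=c-1$: $x$ and $y$ act as
multiplication by $X$ and $Y$, and $[x,y]=1$ (`nonempty_equiv_model`). Its dimension is
$2+n(n+1)/2$.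

The polynomials form an abelian subalgebra of codimension 2. An abelian $H$ is isotropic for every
form $\ell([\cdot,\cdot])$, so $2\dim H\le\dim\mathfrak g+\dim\mathfrak g(\ell)$. If $H$ has
codimension $d$ and some form has rank at least $2d$, this inequality makes both extremal
(`lieIndex_lieAlpha_of_codim`). Here $d=2$, and the coefficient of $XY$ gives rank at least 4; it
requires $2<n$, that is $c\ge 4$. -/

/-! ### Isotropic subspaces, index and abelian subalgebras -/

section IndexBounds

variable {K L L' : Type*} [Field K] [LieRing L] [LieAlgebra K L] [LieRing L'] [LieAlgebra K L']

/-- The linear map `y ↦ (x ↦ ℓ([x, y]))` attached to a linear form `ℓ` on a Lie algebra. -/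
def lieFormMap (l : Module.Dual K L) : L →ₗ[K] Module.Dual K L :=
  LinearMap.mk₂ K (fun y x => l ⁅x, y⁆) (by simp) (by simp) (by simp) (by simp)

theorem ker_lieFormMap (l : Module.Dual K L) :
    LinearMap.ker (lieFormMap l) = (lieFormRadical K L l).toSubmodule := by
  ext y
  exact LinearMap.ext_iff

/-- An abelian subalgebra is isotropic for every form `(x, y) ↦ ℓ([x, y])`, which bounds its
dimension. -/
theorem two_mul_finrank_le_of_isLieAbelian [Module.Finite K L] (l : Module.Dual K L)
    (H : LieSubalgebra K L) (hH : IsLieAbelian H) :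
    2 * Module.finrank K H ≤ Module.finrank K L + Module.finrank K (lieFormRadical K L l) := by
  have hr := LinearMap.finrank_range_add_finrank_ker ((lieFormMap l).domRestrict H.toSubmodule)
  -- Rank-nullity on `H`: the image annihilates `H`, so its dimension is at most the codimension of
  -- `H`, while the kernel embeds in the radical.
  have h1 : LinearMap.range ((lieFormMap l).domRestrict H.toSubmodule) ≤
      H.toSubmodule.dualAnnihilator := by
    rintro _ ⟨y, rfl⟩
    rw [Submodule.mem_dualAnnihilator]
    intro x hx
    have h : ⁅(⟨x, hx⟩ : H), (⟨y.1, y.2⟩ : H)⁆ = 0 := hH.trivial _ _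
    have h' : ⁅x, y.1⁆ = 0 := congrArg Subtype.val h
    change l ⁅x, y.1⁆ = 0
    rw [h', map_zero]
  have h2 := Submodule.finrank_mono h1
  have h3 := Subspace.finrank_add_finrank_dualAnnihilator_eq H.toSubmodule
  have h4 : Module.finrank K (LinearMap.ker ((lieFormMap l).domRestrict H.toSubmodule)) ≤
      Module.finrank K (lieFormRadical K L l) := by
    rw [LinearEquiv.finrank_eq (Submodule.equivMapOfInjective H.toSubmodule.subtype
      (Submodule.subtype_injective _)
      (LinearMap.ker ((lieFormMap l).domRestrict H.toSubmodule)))]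
    apply Submodule.finrank_mono (t := (lieFormRadical K L l).toSubmodule)
    rw [← ker_lieFormMap]
    rintro _ ⟨y, hy, rfl⟩
    exact hy
  have h5 : Module.finrank K H.toSubmodule = Module.finrank K H := rfl
  omega

/-- If an abelian subalgebra of codimension `d` exists and some form `(x, y) ↦ ℓ([x, y])` has
rank at least `2 * d`, then both are extremal. -/
theorem lieIndex_lieAlpha_of_codim [Module.Finite K L] {d : ℕ} (H : LieSubalgebra K L)
    (hH : IsLieAbelian H) (hd : Module.finrank K H + d = Module.finrank K L)
    (l : Module.Dual K L)
    (hl : Module.finrank K (lieFormRadical K L l) + 2 * d ≤ Module.finrank K L) :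
    lieIndex K L + 2 * d = Module.finrank K L ∧ lieAlpha K L + d = Module.finrank K L := by
  obtain ⟨⟨l₀, hl₀⟩, hmin⟩ := lieIndex_isLeast K L
  obtain ⟨⟨H₀, hH₀, hdim⟩, hmax⟩ := lieAlpha_isGreatest K L
  have h1 := hmin ⟨l, rfl⟩
  have h2 := hmax ⟨H, hH, rfl⟩
  -- Pairing the optimal form with the given `H` bounds the index below; pairing the given form with
  -- the optimal `H₀` bounds `lieAlpha` above.
  have h3 := two_mul_finrank_le_of_isLieAbelian l₀ H hH
  have h4 := two_mul_finrank_le_of_isLieAbelian l H₀ hH₀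
  omega

/-- If `n` vectors pair with the whole algebra onto `Kⁿ`, the radical has codimension at least
`n`. -/
theorem finrank_lieFormRadical_add_le [Module.Finite K L] (l : Module.Dual K L) {n : ℕ}
    (x : Fin n → L) (hx : Function.Surjective fun y : L => fun i => l ⁅x i, y⁆) :
    Module.finrank K (lieFormRadical K L l) + n ≤ Module.finrank K L := by
  let G : L →ₗ[K] Fin n → K := LinearMap.pi fun i => (lieFormMap l).flip (x i)
  have hG : Function.Surjective G := hx
  have h := LinearMap.finrank_range_add_finrank_ker G
  rw [LinearMap.range_eq_top.2 hG, finrank_top, Module.finrank_fin_fun] at h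
  have h' : (lieFormRadical K L l).toSubmodule ≤ LinearMap.ker G := by
    intro y hy
    exact funext fun i => hy (x i)
  have h'' : Module.finrank K (lieFormRadical K L l) ≤ Module.finrank K (LinearMap.ker G) :=
    Submodule.finrank_mono h'
  omega

theorem finrank_lieFormRadical_comp_equiv (e : L ≃ₗ⁅K⁆ L') (l : Module.Dual K L') :
    Module.finrank K (lieFormRadical K L (l ∘ₗ e.toLinearEquiv.toLinearMap)) =
      Module.finrank K (lieFormRadical K L' l) := by
  have h : (lieFormRadical K L (l ∘ₗ e.toLinearEquiv.toLinearMap)).toSubmodule.map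
      e.toLinearEquiv.toLinearMap = (lieFormRadical K L' l).toSubmodule := by
    ext y
    constructor
    · rintro ⟨x, hx, rfl⟩ z
      have := hx (e.symm z)
      change l (e ⁅e.symm z, x⁆) = 0 at this
      rw [LieEquiv.map_lie, e.apply_symm_apply] at this
      exact this
    · intro hy
      refine ⟨e.symm y, fun z => ?_, e.apply_symm_apply y⟩
      change l (e ⁅z, e.symm y⁆) = 0
      rw [LieEquiv.map_lie, e.apply_symm_apply]
      exact hy _
  have h2 := LinearEquiv.finrank_map_eq e.toLinearEquiv
    (lieFormRadical K L (l ∘ₗ e.toLinearEquiv.toLinearMap)).toSubmodule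
  exact h2.symm.trans (congrArg (fun S : Submodule K L' => Module.finrank K S) h)

theorem lieIndex_congr (e : L ≃ₗ⁅K⁆ L') : lieIndex K L = lieIndex K L' := by
  unfold lieIndex
  congr 1
  ext d
  constructor
  · rintro ⟨l, rfl⟩
    exact ⟨_, finrank_lieFormRadical_comp_equiv e.symm l⟩
  · rintro ⟨l, rfl⟩
    exact ⟨_, finrank_lieFormRadical_comp_equiv e l⟩

theorem exists_isLieAbelian_of_equiv (e : L ≃ₗ⁅K⁆ L') {d : ℕ}
    (h : ∃ H : LieSubalgebra K L, IsLieAbelian H ∧ Module.finrank K H = d) :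
    ∃ H : LieSubalgebra K L', IsLieAbelian H ∧ Module.finrank K H = d := by
  obtain ⟨H, hH, rfl⟩ := h
  exact ⟨H.map e.toLieHom, (lie_abelian_iff_equiv_lie_abelian (e.lieSubalgebraMap H)).1 hH,
    (e.lieSubalgebraMap H).toLinearEquiv.finrank_eq.symm⟩

theorem lieAlpha_congr (e : L ≃ₗ⁅K⁆ L') : lieAlpha K L = lieAlpha K L' := by
  unfold lieAlpha
  congr 1
  ext d
  exact ⟨exists_isLieAbelian_of_equiv e, exists_isLieAbelian_of_equiv e.symm⟩

end IndexBounds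

/-! ### Truncated polynomials in two variables -/

section MetabelianModel

/-- Exponents of the monomials of degree less than `n` in two variables. -/
abbrev TruncExponent (n : ℕ) : Type := {p : ℕ × ℕ // p.1 + p.2 < n}

/-- The exponents of degree less than `n`, sorted by degree. -/
def truncExponentEquiv (n : ℕ) :
    TruncExponent n ≃ Σ k : Fin n, {p : ℕ × ℕ // p ∈ Finset.HasAntidiagonal.antidiagonal (k : ℕ)} where
  toFun p := ⟨⟨p.1.1 + p.1.2, p.2⟩, ⟨p.1, by simp⟩⟩
  invFun q := ⟨q.2.1, by
    have := Finset.HasAntidiagonal.mem_antidiagonal.1 q.2.2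
    have := q.1.2
    omega⟩
  left_inv _ := rfl
  right_inv := by
    rintro ⟨⟨k, hk⟩, ⟨⟨i, j⟩, h⟩⟩
    obtain rfl := Finset.HasAntidiagonal.mem_antidiagonal.1 h
    rfl

instance (n : ℕ) : Fintype (TruncExponent n) :=
  Fintype.ofEquiv _ (truncExponentEquiv n).symm

theorem two_mul_card_truncExponent (n : ℕ) :
    2 * Fintype.card (TruncExponent n) = n * (n + 1) := by
  rw [Fintype.card_congr (truncExponentEquiv n), Fintype.card_sigma]
  simp only [Fintype.card_coe, Finset.Nat.card_antidiagonal]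
  rw [Fin.sum_univ_eq_sum_range (fun k => k + 1) n]
  induction n with
  | zero => rfl
  | succ n ih => rw [Finset.sum_range_succ, mul_add, ih]; ring

variable (K : Type*) [Field K] (n : ℕ)

/-- Polynomials in two variables truncated at degree `n`. -/
abbrev TruncPoly : Type _ := TruncExponent n →₀ K

namespace TruncPoly

/-- The monomial with exponents `i, j`, which vanishes in degrees at least `n`. -/
noncomputable def mono (i j : ℕ) : TruncPoly K n :=
  if h : i + j < n then Finsupp.single ⟨(i, j), h⟩ 1 else 0

theorem mono_of_le {i j : ℕ} (h : n ≤ i + j) : mono K n i j = 0 := dif_neg (by omega)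

theorem mono_of_lt {i j : ℕ} (h : i + j < n) : mono K n i j = Finsupp.single ⟨(i, j), h⟩ 1 :=
  dif_pos h

variable {K n} in
theorem hom_ext {V : Type*} [AddCommGroup V] [Module K V] {f g : TruncPoly K n →ₗ[K] V}
    (h : ∀ i j, f (mono K n i j) = g (mono K n i j)) : f = g := by
  refine Finsupp.lhom_ext' fun p => LinearMap.ext_ring ?_
  have := h p.1.1 p.1.2
  rwa [mono_of_lt K n p.2] at this

variable {K} in
/-- The linear map sending the monomials of degree less than `n` to prescribed values. -/
noncomputable def liftMono {V : Type*} [AddCommGroup V] [Module K V] (v : ℕ → ℕ → V) :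
    TruncPoly K n →ₗ[K] V :=
  Finsupp.linearCombination K fun p => v p.1.1 p.1.2

-- The vanishing of `v` in degrees at least `n` makes the formula hold for all exponents, including
-- those whose monomial is zero.
variable {K} in
theorem liftMono_mono {V : Type*} [AddCommGroup V] [Module K V] {v : ℕ → ℕ → V}
    (hv : ∀ i j, n ≤ i + j → v i j = 0) (i j : ℕ) : liftMono n v (mono K n i j) = v i j := by
  by_cases h : i + j < n
  · rw [mono_of_lt K n h, liftMono, Finsupp.linearCombination_single, one_smul]
  · rw [mono_of_le K n (not_lt.1 h), map_zero, hv i j (not_lt.1 h)]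

/-- Multiplication by the first variable. -/
noncomputable def mulX : TruncPoly K n →ₗ[K] TruncPoly K n :=
  liftMono n fun i j => mono K n (i + 1) j

/-- Multiplication by the second variable. -/
noncomputable def mulY : TruncPoly K n →ₗ[K] TruncPoly K n :=
  liftMono n fun i j => mono K n i (j + 1)

@[simp]
theorem mulX_mono (i j : ℕ) : mulX K n (mono K n i j) = mono K n (i + 1) j :=
  liftMono_mono n (fun _ _ h => mono_of_le K n (by omega)) i j

@[simp]
theorem mulY_mono (i j : ℕ) : mulY K n (mono K n i j) = mono K n i (j + 1) :=
  liftMono_mono n (fun _ _ h => mono_of_le K n (by omega)) i j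

theorem mulX_mulY (a : TruncPoly K n) : mulX K n (mulY K n a) = mulY K n (mulX K n a) :=
  LinearMap.congr_fun
    (hom_ext (f := mulX K n ∘ₗ mulY K n) (g := mulY K n ∘ₗ mulX K n) (by simp)) a

/-- The truncated polynomials without terms of degree less than `k`. -/
noncomputable def filtration (k : ℕ) : Submodule K (TruncPoly K n) :=
  Submodule.span K {a | ∃ i j, k ≤ i + j ∧ mono K n i j = a}

theorem filtration_zero : filtration K n 0 = ⊤ := by
  have h : (filtration K n 0).mkQ = 0 := hom_ext fun i j => by
    rw [LinearMap.zero_apply, Submodule.mkQ_apply, Submodule.Quotient.mk_eq_zero]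
    exact Submodule.subset_span ⟨i, j, Nat.zero_le _, rfl⟩
  rw [← Submodule.ker_mkQ (filtration K n 0), h, LinearMap.ker_zero]

theorem filtration_eq_bot : filtration K n n = ⊥ := by
  rw [filtration, Submodule.span_eq_bot]
  rintro _ ⟨i, j, h, rfl⟩
  exact mono_of_le K n h

theorem filtration_succ_le (k : ℕ) : filtration K n (k + 1) ≤ filtration K n k :=
  Submodule.span_mono fun _ ⟨i, j, h, e⟩ => ⟨i, j, by omega, e⟩

variable {K n} in
theorem mulX_mem_filtration {k : ℕ} {a : TruncPoly K n} (ha : a ∈ filtration K n k) :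
    mulX K n a ∈ filtration K n (k + 1) := by
  refine (Submodule.map_span_le (mulX K n) _ _).2 ?_ (Submodule.mem_map_of_mem ha)
  rintro _ ⟨i, j, h, rfl⟩
  exact Submodule.subset_span ⟨i + 1, j, by omega, (mulX_mono K n i j).symm⟩

variable {K n} in
theorem mulY_mem_filtration {k : ℕ} {a : TruncPoly K n} (ha : a ∈ filtration K n k) :
    mulY K n a ∈ filtration K n (k + 1) := by
  refine (Submodule.map_span_le (mulY K n) _ _).2 ?_ (Submodule.mem_map_of_mem ha)
  rintro _ ⟨i, j, h, rfl⟩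
  exact Submodule.subset_span ⟨i, j + 1, by omega, (mulY_mono K n i j).symm⟩

end TruncPoly

/-! ### The model Lie algebra -/

open TruncPoly

/-- A concrete model of the free metabelian Lie algebra of class `n + 1` on two generators: the
plane extended by the truncated polynomials, on which it acts by multiplication. -/
def MetabelianModel : Type _ := K × K × TruncPoly K n

namespace MetabelianModel

noncomputable instance : AddCommGroup (MetabelianModel K n) :=
  inferInstanceAs (AddCommGroup (K × K × TruncPoly K n))

noncomputable instance : Module K (MetabelianModel K n) :=
  inferInstanceAs (Module K (K × K × TruncPoly K n))

instance : Module.Finite K (MetabelianModel K n) :=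
  inferInstanceAs (Module.Finite K (K × K × TruncPoly K n))

variable {K n}

/-- The first plane coordinate. -/
noncomputable def fst : MetabelianModel K n →ₗ[K] K := LinearMap.fst K K (K × TruncPoly K n)

/-- The second plane coordinate. -/
noncomputable def snd : MetabelianModel K n →ₗ[K] K :=
  LinearMap.fst K K (TruncPoly K n) ∘ₗ LinearMap.snd K K (K × TruncPoly K n)

/-- The polynomial component. -/
noncomputable def poly : MetabelianModel K n →ₗ[K] TruncPoly K n :=
  LinearMap.snd K K (TruncPoly K n) ∘ₗ LinearMap.snd K K (K × TruncPoly K n)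

/-- The inclusion of the truncated polynomials. -/
noncomputable def ofPoly : TruncPoly K n →ₗ[K] MetabelianModel K n :=
  LinearMap.inr K K (K × TruncPoly K n) ∘ₗ LinearMap.inr K K (TruncPoly K n)

/-- The first generator. -/
noncomputable def genX : MetabelianModel K n := ((1, 0, 0) : K × K × TruncPoly K n)

/-- The second generator. -/
noncomputable def genY : MetabelianModel K n := ((0, 1, 0) : K × K × TruncPoly K n)

@[simp] theorem fst_ofPoly (a : TruncPoly K n) : fst (ofPoly a) = 0 := rfl
@[simp] theorem snd_ofPoly (a : TruncPoly K n) : snd (ofPoly a) = 0 := rfl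
@[simp] theorem poly_ofPoly (a : TruncPoly K n) : poly (ofPoly a) = a := rfl
@[simp] theorem fst_genX : fst (genX : MetabelianModel K n) = 1 := rfl
@[simp] theorem snd_genX : snd (genX : MetabelianModel K n) = 0 := rfl
@[simp] theorem poly_genX : poly (genX : MetabelianModel K n) = 0 := rfl
@[simp] theorem fst_genY : fst (genY : MetabelianModel K n) = 0 := rfl
@[simp] theorem snd_genY : snd (genY : MetabelianModel K n) = 1 := rfl
@[simp] theorem poly_genY : poly (genY : MetabelianModel K n) = 0 := rfl

theorem ext {u v : MetabelianModel K n} (h1 : fst u = fst v) (h2 : snd u = snd v)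
    (h3 : poly u = poly v) : u = v :=
  Prod.ext h1 (Prod.ext h2 h3)

theorem eq_sum (u : MetabelianModel K n) :
    u = fst u • genX + snd u • genY + ofPoly (poly u) :=
  ext (by simp) (by simp) (by simp)

/-- The polynomial component of the bracket. -/
noncomputable def bracketPoly (u v : MetabelianModel K n) : TruncPoly K n :=
  fst u • mulX K n (poly v) + snd u • mulY K n (poly v) -
      (fst v • mulX K n (poly u) + snd v • mulY K n (poly u)) +
    (fst u * snd v - snd u * fst v) • mono K n 0 0

noncomputable instance : Bracket (MetabelianModel K n) (MetabelianModel K n) :=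
  ⟨fun u v => ofPoly (bracketPoly u v)⟩

theorem bracket_def (u v : MetabelianModel K n) : ⁅u, v⁆ = ofPoly (bracketPoly u v) := rfl

noncomputable instance : LieRing (MetabelianModel K n) where
  add_lie u v w := by
    simp only [bracket_def, ← map_add]
    congr 1
    simp only [bracketPoly, map_add]
    module
  lie_add u v w := by
    simp only [bracket_def, ← map_add]
    congr 1
    simp only [bracketPoly, map_add]
    module
  lie_self u := by
    rw [bracket_def, show bracketPoly u u = 0 by unfold bracketPoly; module, map_zero]
  leibniz_lie u v w := by
    -- A bracket has no plane component, so the Jacobi identity reduces to the commutation of `mulX`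
    -- and `mulY`, plus multiples of $X$ and $Y$ coming from $[x,y]=1$.
    simp only [bracket_def, ← map_add]
    congr 1
    simp only [bracketPoly, map_add, map_sub, map_smul, fst_ofPoly, snd_ofPoly, poly_ofPoly,
      mulX_mulY, mulX_mono, mulY_mono]
    module

noncomputable instance : LieAlgebra K (MetabelianModel K n) where
  lie_smul t u v := by
    simp only [bracket_def, ← map_smul]
    congr 1
    simp only [bracketPoly, map_smul, smul_eq_mul]
    module

theorem fst_lie (u v : MetabelianModel K n) : fst ⁅u, v⁆ = 0 := rfl
theorem snd_lie (u v : MetabelianModel K n) : snd ⁅u, v⁆ = 0 := rfl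
theorem poly_lie (u v : MetabelianModel K n) : poly ⁅u, v⁆ = bracketPoly u v := rfl

variable (K n) in
/-- The ideal of polynomials without terms of degree less than `k`. -/
noncomputable def polyIdeal (k : ℕ) : LieIdeal K (MetabelianModel K n) where
  toSubmodule := LinearMap.ker fst ⊓ LinearMap.ker snd ⊓ (filtration K n k).comap poly
  lie_mem := by
    rintro u v ⟨⟨h1, h2⟩, h3⟩
    replace h1 : fst v = 0 := h1
    replace h2 : snd v = 0 := h2
    refine ⟨⟨rfl, rfl⟩, ?_⟩
    change bracketPoly u v ∈ filtration K n k
    simp only [bracketPoly, h1, h2, zero_smul, add_zero, sub_zero, mul_zero]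
    exact filtration_succ_le K n k (Submodule.add_mem _
      (Submodule.smul_mem _ _ (mulX_mem_filtration h3))
      (Submodule.smul_mem _ _ (mulY_mem_filtration h3)))

theorem mem_polyIdeal {k : ℕ} {u : MetabelianModel K n} :
    u ∈ polyIdeal K n k ↔ (fst u = 0 ∧ snd u = 0) ∧ poly u ∈ filtration K n k := Iff.rfl

theorem lie_mem_polyIdeal_zero (u v : MetabelianModel K n) : ⁅u, v⁆ ∈ polyIdeal K n 0 := by
  refine ⟨⟨rfl, rfl⟩, ?_⟩
  rw [filtration_zero]
  exact Submodule.mem_top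

theorem lie_mem_polyIdeal_succ {k : ℕ} (u : MetabelianModel K n) {v : MetabelianModel K n}
    (hv : v ∈ polyIdeal K n k) : ⁅u, v⁆ ∈ polyIdeal K n (k + 1) := by
  obtain ⟨⟨h1, h2⟩, h3⟩ := mem_polyIdeal.1 hv
  refine mem_polyIdeal.2 ⟨⟨rfl, rfl⟩, ?_⟩
  rw [poly_lie]
  simp only [bracketPoly, h1, h2, zero_smul, add_zero, sub_zero, mul_zero]
  exact Submodule.add_mem _ (Submodule.smul_mem _ _ (mulX_mem_filtration h3))
    (Submodule.smul_mem _ _ (mulY_mem_filtration h3))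

theorem lie_eq_zero_of_mem_polyIdeal {u v : MetabelianModel K n} (hu : u ∈ polyIdeal K n 0)
    (hv : v ∈ polyIdeal K n 0) : ⁅u, v⁆ = 0 := by
  obtain ⟨⟨h1, h2⟩, -⟩ := mem_polyIdeal.1 hu
  obtain ⟨⟨h3, h4⟩, -⟩ := mem_polyIdeal.1 hv
  rw [bracket_def, bracketPoly, h1, h2, h3, h4]
  simp

/-- The first bracket lands in the polynomials, with no gain in degree; each further one raises the
degree by one. Hence the shift, and nilpotency class at most `n + 1`. -/
theorem lowerCentralSeries_le_polyIdeal (k : ℕ) :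
    LieModule.lowerCentralSeries K (MetabelianModel K n) (MetabelianModel K n) (k + 1) ≤
      polyIdeal K n k := by
  induction k with
  | zero =>
    rw [LieModule.lowerCentralSeries_succ, LieSubmodule.lieIdeal_oper_eq_span,
      LieSubmodule.lieSpan_le]
    rintro _ ⟨u, v, rfl⟩
    exact lie_mem_polyIdeal_zero _ _
  | succ k ih =>
    rw [LieModule.lowerCentralSeries_succ, LieSubmodule.lieIdeal_oper_eq_span,
      LieSubmodule.lieSpan_le]
    rintro _ ⟨u, v, rfl⟩
    exact lie_mem_polyIdeal_succ _ (ih v.2)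

variable (K n)

theorem lowerCentralSeries_eq_bot :
    LieModule.lowerCentralSeries K (MetabelianModel K n) (MetabelianModel K n) (n + 1) = ⊥ := by
  rw [eq_bot_iff]
  intro u hu
  obtain ⟨⟨h1, h2⟩, h3⟩ := mem_polyIdeal.1 (lowerCentralSeries_le_polyIdeal n hu)
  rw [filtration_eq_bot] at h3
  exact (LieSubmodule.mem_bot _).2 (ext h1 h2 ((Submodule.mem_bot K).1 h3))

theorem derivedSeries_eq_bot : LieAlgebra.derivedSeries K (MetabelianModel K n) 2 = ⊥ := by
  have h1 : LieAlgebra.derivedSeries K (MetabelianModel K n) 1 ≤ polyIdeal K n 0 := by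
    rw [LieAlgebra.derivedSeries_def, LieAlgebra.derivedSeriesOfIdeal_succ K _ _ 0, LieSubmodule.lieIdeal_oper_eq_span,
      LieSubmodule.lieSpan_le]
    rintro _ ⟨u, v, rfl⟩
    exact lie_mem_polyIdeal_zero _ _
  rw [LieAlgebra.derivedSeries_def, LieAlgebra.derivedSeriesOfIdeal_succ, eq_bot_iff,
    LieSubmodule.lieIdeal_oper_eq_span, LieSubmodule.lieSpan_le]
  rintro _ ⟨u, v, rfl⟩
  exact lie_eq_zero_of_mem_polyIdeal (h1 u.2) (h1 v.2)

theorem two_mul_finrank :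
    2 * Module.finrank K (MetabelianModel K n) = 4 + n * (n + 1) := by
  have h : Module.finrank K (MetabelianModel K n) = Module.finrank K (K × K × TruncPoly K n) := rfl
  rw [h, Module.finrank_prod, Module.finrank_prod, Module.finrank_self,
    Module.finrank_finsupp_self, ← two_mul_card_truncExponent]
  ring

/-- The abelian subalgebra of truncated polynomials. -/
noncomputable def polySubalgebra : LieSubalgebra K (MetabelianModel K n) :=
  { LinearMap.range (ofPoly (K := K) (n := n)) with
    lie_mem' := fun {u v} _ _ => ⟨bracketPoly u v, rfl⟩ }

theorem isLieAbelian_polySubalgebra : IsLieAbelian (polySubalgebra K n) := by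
  refine ⟨?_⟩
  rintro ⟨_, a, rfl⟩ ⟨_, b, rfl⟩
  apply Subtype.ext
  change ⁅ofPoly a, ofPoly b⁆ = 0
  rw [bracket_def]
  simp [bracketPoly]

theorem finrank_polySubalgebra :
    Module.finrank K (polySubalgebra K n) + 2 = Module.finrank K (MetabelianModel K n) := by
  have hinj : Function.Injective (ofPoly (K := K) (n := n)) := fun a b h => congrArg poly h
  have h1 : Module.finrank K (polySubalgebra K n) = Module.finrank K (TruncPoly K n) :=
    LinearMap.finrank_range_of_inj hinj
  have h2 : Module.finrank K (MetabelianModel K n) =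
    Module.finrank K (K × K × TruncPoly K n) := rfl
  rw [h1, h2, Module.finrank_prod, Module.finrank_prod, Module.finrank_self]
  ring

/-! ### A form of rank at least four -/

variable {n}

/-- The coefficient of the monomial `XY`. -/
noncomputable def coeffXY (hn : 3 ≤ n) : Module.Dual K (MetabelianModel K n) :=
  Finsupp.lapply (⟨(1, 1), by omega⟩ : TruncExponent n) ∘ₗ poly

/-- Since $XY=X\cdot Y=Y\cdot X$, the form pairs `genX` with $Y$ and `genY` with $X$; all other
pairings among these four vectors vanish. -/
theorem finrank_lieFormRadical_coeffXY (hn : 3 ≤ n) :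
    Module.finrank K (lieFormRadical K (MetabelianModel K n) (coeffXY K hn)) + 2 * 2 ≤
      Module.finrank K (MetabelianModel K n) := by
  have hc : ∀ i j : ℕ, mono K n i j ⟨(1, 1), by omega⟩ = if i = 1 ∧ j = 1 then 1 else 0 := by
    intro i j
    by_cases h : i + j < n
    · rw [mono_of_lt K n h, Finsupp.single_apply]
      simp [Prod.ext_iff]
    · rw [mono_of_le K n (not_lt.1 h), if_neg (by omega)]
      rfl
  apply finrank_lieFormRadical_add_le _
    ![genX, genY, ofPoly (mono K n 1 0), ofPoly (mono K n 0 1)]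
  intro t
  -- Each coordinate of `t` is placed on the partner of the corresponding vector, with a minus sign
  -- where the order of the bracket is reversed.
  refine ⟨(-t 3) • genX + (-t 2) • genY + t 1 • ofPoly (mono K n 1 0) +
    t 0 • ofPoly (mono K n 0 1), ?_⟩
  funext i
  fin_cases i <;>
    simp [coeffXY, poly_lie, bracketPoly, hc]

theorem lieIndex_lieAlpha (hn : 3 ≤ n) :
    lieIndex K (MetabelianModel K n) + 4 = Module.finrank K (MetabelianModel K n) ∧
      lieAlpha K (MetabelianModel K n) + 2 = Module.finrank K (MetabelianModel K n) :=
  lieIndex_lieAlpha_of_codim (polySubalgebra K n) (isLieAbelian_polySubalgebra K n)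
    (finrank_polySubalgebra K n) (coeffXY K hn) (finrank_lieFormRadical_coeffXY K hn)

end MetabelianModel

end MetabelianModel

/-! ### Universal property of the model -/

section Presentation

open TruncPoly

namespace MetabelianModel

variable {K L : Type*} [Field K] [LieRing L] [LieAlgebra K L] {n : ℕ}

theorem lie_mem_derivedSeries_one (x y : L) : ⁅x, y⁆ ∈ LieAlgebra.derivedSeries K L 1 :=
  LieSubmodule.lie_mem_lie (LieSubmodule.mem_top x) (LieSubmodule.mem_top y)

theorem lie_eq_zero_of_mem_derivedSeries_one (hD : LieAlgebra.derivedSeries K L 2 = ⊥) {u v : L}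
    (hu : u ∈ LieAlgebra.derivedSeries K L 1) (hv : v ∈ LieAlgebra.derivedSeries K L 1) :
    ⁅u, v⁆ = 0 := by
  rw [← LieSubmodule.mem_bot (R := K) (L := L), ← hD]
  exact LieSubmodule.lie_mem_lie hu hv

variable (K) in
/-- The iterated bracket `ad(x)^i ad(y)^j [x, y]`. -/
noncomputable def iterLie (x y : L) (i j : ℕ) : L :=
  (LieAlgebra.ad K L x)^[i] ((LieAlgebra.ad K L y)^[j] ⁅x, y⁆)

theorem iterLie_mem_lowerCentralSeries (x y : L) (i j : ℕ) :
    iterLie K x y i j ∈ LieModule.lowerCentralSeries K L L (i + j + 1) := by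
  induction i with
  | zero =>
    rw [iterLie, Function.iterate_zero, id]
    induction j with
    | zero =>
      rw [LieModule.lowerCentralSeries_succ]
      exact LieSubmodule.lie_mem_lie (LieSubmodule.mem_top _) (LieSubmodule.mem_top _)
    | succ j ih =>
      rw [Function.iterate_succ_apply', LieModule.lowerCentralSeries_succ]
      exact LieSubmodule.lie_mem_lie (LieSubmodule.mem_top _) ih
  | succ i ih =>
    rw [iterLie, Function.iterate_succ_apply',
      show i + 1 + j + 1 = (i + j + 1) + 1 by ring, LieModule.lowerCentralSeries_succ]
    exact LieSubmodule.lie_mem_lie (LieSubmodule.mem_top _) ih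

theorem iterLie_mem_derivedSeries_one (x y : L) (i j : ℕ) :
    iterLie K x y i j ∈ LieAlgebra.derivedSeries K L 1 := by
  have h := LieModule.antitone_lowerCentralSeries K L L (show 1 ≤ i + j + 1 by omega)
    (iterLie_mem_lowerCentralSeries x y i j)
  rw [LieModule.lowerCentralSeries_succ] at h
  exact h

theorem iterLie_succ_left (x y : L) (i j : ℕ) :
    iterLie K x y (i + 1) j = ⁅x, iterLie K x y i j⁆ :=
  Function.iterate_succ_apply' _ _ _

/-- The commutator of `ad y` and `ad x` is `ad ⁅y, x⁆`, which kills the derived algebra of a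
metabelian Lie algebra; so `ad y` moves past the powers of `ad x`. -/
theorem iterLie_succ_right (hD : LieAlgebra.derivedSeries K L 2 = ⊥) (x y : L) (i j : ℕ) :
    iterLie K x y i (j + 1) = ⁅y, iterLie K x y i j⁆ := by
  induction i with
  | zero => exact Function.iterate_succ_apply' _ _ _
  | succ i ih =>
    have h : ⁅⁅y, x⁆, iterLie K x y i j⁆ = 0 :=
      lie_eq_zero_of_mem_derivedSeries_one hD (lie_mem_derivedSeries_one _ _)
        (iterLie_mem_derivedSeries_one _ _ _ _)
    rw [iterLie_succ_left, iterLie_succ_left, ih, leibniz_lie y, h, zero_add]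

variable (K n) in
/-- Evaluation of truncated polynomials at iterated brackets. -/
noncomputable def evalPoly (x y : L) : TruncPoly K n →ₗ[K] L := liftMono n (iterLie K x y)

/-- Nilpotency is what makes evaluation compatible with truncation: iterated brackets with `n ≤ i +
j` vanish. -/
theorem evalPoly_mono (hL : LieModule.lowerCentralSeries K L L (n + 1) = ⊥) (x y : L) (i j : ℕ) :
    evalPoly K n x y (mono K n i j) = iterLie K x y i j := by
  refine liftMono_mono n (fun i j h => ?_) i j
  rw [← LieSubmodule.mem_bot (R := K) (L := L), ← hL]
  exact LieModule.antitone_lowerCentralSeries K L L (by omega)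
    (iterLie_mem_lowerCentralSeries x y i j)

theorem evalPoly_mulX (hL : LieModule.lowerCentralSeries K L L (n + 1) = ⊥) (x y : L)
    (a : TruncPoly K n) : evalPoly K n x y (mulX K n a) = ⁅x, evalPoly K n x y a⁆ :=
  LinearMap.congr_fun (TruncPoly.hom_ext (f := evalPoly K n x y ∘ₗ mulX K n)
    (g := (LieAlgebra.ad K L x : L →ₗ[K] L) ∘ₗ evalPoly K n x y) fun i j => by
      simp [evalPoly_mono hL, iterLie_succ_left]) a

theorem evalPoly_mulY (hL : LieModule.lowerCentralSeries K L L (n + 1) = ⊥)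
    (hD : LieAlgebra.derivedSeries K L 2 = ⊥) (x y : L)
    (a : TruncPoly K n) : evalPoly K n x y (mulY K n a) = ⁅y, evalPoly K n x y a⁆ :=
  LinearMap.congr_fun (TruncPoly.hom_ext (f := evalPoly K n x y ∘ₗ mulY K n)
    (g := (LieAlgebra.ad K L y : L →ₗ[K] L) ∘ₗ evalPoly K n x y) fun i j => by
      simp [evalPoly_mono hL, iterLie_succ_right hD]) a

theorem evalPoly_mem_derivedSeries_one (x y : L) (a : TruncPoly K n) :
    evalPoly K n x y a ∈ LieAlgebra.derivedSeries K L 1 :=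
  Submodule.sum_mem _ fun _ _ => Submodule.smul_mem _ _ (iterLie_mem_derivedSeries_one _ _ _ _)

variable (K n) in
/-- The linear map from the model determined by the images of the two generators. -/
noncomputable def evalLinear (x y : L) : MetabelianModel K n →ₗ[K] L :=
  fst.smulRight x + snd.smulRight y + evalPoly K n x y ∘ₗ poly

theorem evalLinear_apply (x y : L) (u : MetabelianModel K n) :
    evalLinear K n x y u = fst u • x + snd u • y + evalPoly K n x y (poly u) := rfl

/-- Evaluation turns `mulX` and `mulY` into `ad x` and `ad y` and sends $1$ to `⁅x, y⁆`; values of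
polynomials commute with each other by metabelianity. -/
theorem evalLinear_lie (hL : LieModule.lowerCentralSeries K L L (n + 1) = ⊥)
    (hD : LieAlgebra.derivedSeries K L 2 = ⊥) (x y : L) (u v : MetabelianModel K n) :
    evalLinear K n x y ⁅u, v⁆ = ⁅evalLinear K n x y u, evalLinear K n x y v⁆ := by
  have h0 : ⁅evalPoly K n x y (poly u), evalPoly K n x y (poly v)⁆ = 0 :=
    lie_eq_zero_of_mem_derivedSeries_one hD (evalPoly_mem_derivedSeries_one x y _)
      (evalPoly_mem_derivedSeries_one x y _)
  have h1 : ⁅evalPoly K n x y (poly u), x⁆ = -⁅x, evalPoly K n x y (poly u)⁆ :=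
    (lie_skew _ _).symm
  have h2 : ⁅evalPoly K n x y (poly u), y⁆ = -⁅y, evalPoly K n x y (poly u)⁆ :=
    (lie_skew _ _).symm
  have h3 : ⁅y, x⁆ = -⁅x, y⁆ := (lie_skew _ _).symm
  have h4 : iterLie K x y 0 0 = ⁅x, y⁆ := rfl
  simp only [evalLinear_apply, fst_lie, snd_lie, poly_lie, bracketPoly, map_add, map_sub, map_smul,
    evalPoly_mulX hL, evalPoly_mulY hL hD, evalPoly_mono hL, add_lie, lie_add, smul_lie, lie_smul,
    h0, h1, h2, h3, h4, lie_self]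
  module

/-- The universal property of the model among metabelian Lie algebras of class `n + 1`. -/
noncomputable def evalHom (hL : LieModule.lowerCentralSeries K L L (n + 1) = ⊥)
    (hD : LieAlgebra.derivedSeries K L 2 = ⊥) (x y : L) : MetabelianModel K n →ₗ⁅K⁆ L :=
  { evalLinear K n x y with map_lie' := evalLinear_lie hL hD x y _ _ }

theorem evalHom_genX (hL : LieModule.lowerCentralSeries K L L (n + 1) = ⊥)
    (hD : LieAlgebra.derivedSeries K L 2 = ⊥) (x y : L) : evalHom hL hD x y genX = x := by
  change evalLinear K n x y genX = x
  simp [evalLinear_apply]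

theorem evalHom_genY (hL : LieModule.lowerCentralSeries K L L (n + 1) = ⊥)
    (hD : LieAlgebra.derivedSeries K L 2 = ⊥) (x y : L) : evalHom hL hD x y genY = y := by
  change evalLinear K n x y genY = y
  simp [evalLinear_apply]

/-- The generators produce every monomial, so a morphism returning `x` and `y` to them inverts the
evaluation on the left. -/
theorem iterLie_gen (i j : ℕ) :
    iterLie K (genX : MetabelianModel K n) genY i j = ofPoly (mono K n i j) := by
  induction i with
  | zero =>
    induction j with
    | zero =>
      change ⁅(genX : MetabelianModel K n), genY⁆ = _
      rw [bracket_def]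
      simp [bracketPoly]
    | succ j ih =>
      rw [iterLie_succ_right (derivedSeries_eq_bot K n), ih, bracket_def]
      simp [bracketPoly]
  | succ i ih =>
    rw [iterLie_succ_left, ih, bracket_def]
    simp [bracketPoly]

/-- The evaluation morphism is injective if some morphism sends `x` and `y` back to the
generators. -/
theorem evalHom_injective (hL : LieModule.lowerCentralSeries K L L (n + 1) = ⊥)
    (hD : LieAlgebra.derivedSeries K L 2 = ⊥) (x y : L) (g : L →ₗ⁅K⁆ MetabelianModel K n)
    (hx : g x = genX) (hy : g y = genY) : Function.Injective (evalHom hL hD x y) := by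
  have hiter : ∀ i j, g (iterLie K x y i j) = ofPoly (mono K n i j) := by
    intro i j
    rw [← iterLie_gen]
    induction i with
    | zero =>
      induction j with
      | zero =>
        change g ⁅x, y⁆ = ⁅genX, genY⁆
        rw [LieHom.map_lie, hx, hy]
      | succ j ih =>
        rw [iterLie_succ_right hD, iterLie_succ_right (derivedSeries_eq_bot K n), LieHom.map_lie,
          ih, hy]
    | succ i ih => rw [iterLie_succ_left, iterLie_succ_left, LieHom.map_lie, ih, hx]
  have hpoly : ∀ a, g (evalPoly K n x y a) = ofPoly a :=
    LinearMap.congr_fun (TruncPoly.hom_ext (f := (g : L →ₗ[K] MetabelianModel K n) ∘ₗ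
      evalPoly K n x y) (g := ofPoly) fun i j => by simp [evalPoly_mono hL, hiter])
  refine Function.LeftInverse.injective (g := g) fun u => ?_
  change g (evalLinear K n x y u) = u
  rw [evalLinear_apply, map_add, map_add, map_smul, map_smul, hx, hy, hpoly, ← eq_sum]

end MetabelianModel

/-! ### Identification of the free metabelian Lie algebra with the model -/

section Quotients

variable {K L L' : Type*} [Field K] [LieRing L] [LieAlgebra K L] [LieRing L'] [LieAlgebra K L']

/-- The projection onto the quotient by an ideal, as a morphism of Lie algebras. -/
def lieQuotMk (I : LieIdeal K L) : L →ₗ⁅K⁆ L ⧸ I :=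
  { I.toSubmodule.mkQ with map_lie' := fun {_ _} => rfl }

theorem lieQuotMk_surjective (I : LieIdeal K L) : Function.Surjective (lieQuotMk I) :=
  Submodule.mkQ_surjective _

theorem map_lieQuotMk (I : LieIdeal K L) : LieIdeal.map (lieQuotMk I) I = ⊥ := by
  rw [LieIdeal.map_eq_bot_iff]
  intro x hx
  rw [LieHom.mem_ker]
  exact (Submodule.Quotient.mk_eq_zero _).2 hx

/-- The morphism induced on the quotient by an ideal contained in the kernel. -/
def lieQuotLift (I : LieIdeal K L) (f : L →ₗ⁅K⁆ L') (h : I ≤ f.ker) : L ⧸ I →ₗ⁅K⁆ L' :=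
  { I.toSubmodule.liftQ (f : L →ₗ[K] L') fun x hx => f.mem_ker.1 (h hx) with
    map_lie' := by
      intro x y
      obtain ⟨x, rfl⟩ := lieQuotMk_surjective I x
      obtain ⟨y, rfl⟩ := lieQuotMk_surjective I y
      exact f.map_lie x y }

end Quotients

namespace FreeMetabelianLie

variable (K : Type*) [Field K] (g c : ℕ)

/-- The projection from the free Lie algebra. -/
noncomputable def proj : FreeLieAlgebra K (Fin g) →ₗ⁅K⁆ FreeMetabelianLie K g c :=
  (lieQuotMk _).comp (lieQuotMk _)

theorem proj_surjective : Function.Surjective (proj K g c) :=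
  (lieQuotMk_surjective _).comp (lieQuotMk_surjective _)

theorem lowerCentralSeries_eq_bot : LieModule.lowerCentralSeries K (FreeMetabelianLie K g c)
    (FreeMetabelianLie K g c) c = ⊥ := by
  rw [← LieIdeal.lowerCentralSeries_map_eq c (lieQuotMk_surjective
    (secondDerivedIdeal K (FreeNilpotentLie K g c))),
    ← LieIdeal.lowerCentralSeries_map_eq c (lieQuotMk_surjective
    (LieModule.lowerCentralSeries K (FreeLieAlgebra K (Fin g)) (FreeLieAlgebra K (Fin g)) c)),
    map_lieQuotMk, LieIdeal.map_eq_bot_iff]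
  exact bot_le

theorem derivedSeries_eq_bot : LieAlgebra.derivedSeries K (FreeMetabelianLie K g c) 2 = ⊥ := by
  rw [← LieIdeal.derivedSeries_map_eq 2 (lieQuotMk_surjective
    (secondDerivedIdeal K (FreeNilpotentLie K g c)))]
  -- `secondDerivedIdeal` is by definition the second term of the derived series.
  exact map_lieQuotMk _

variable {K g c} {L : Type*} [LieRing L] [LieAlgebra K L]

/-- The universal property of the free `c`-step nilpotent metabelian Lie algebra. -/
noncomputable def lift (hL : LieModule.lowerCentralSeries K L L c = ⊥)
    (hD : LieAlgebra.derivedSeries K L 2 = ⊥) (f : Fin g → L) :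
    FreeMetabelianLie K g c →ₗ⁅K⁆ L :=
  lieQuotLift _ (lieQuotLift _ (FreeLieAlgebra.lift K f) (by
      rw [← LieIdeal.map_eq_bot_iff, eq_bot_iff, ← hL]
      exact LieIdeal.map_lowerCentralSeries_le c)) (by
    rw [← LieIdeal.map_eq_bot_iff]
    exact eq_bot_iff.2 ((LieIdeal.derivedSeries_map_le 2).trans hD.le))

theorem lift_proj (hL : LieModule.lowerCentralSeries K L L c = ⊥)
    (hD : LieAlgebra.derivedSeries K L 2 = ⊥) (f : Fin g → L) (i : Fin g) :
    lift hL hD f (proj K g c (FreeLieAlgebra.of K i)) = f i :=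
  FreeLieAlgebra.lift_of_apply f i

variable (K)

open MetabelianModel in
/-- The free metabelian Lie algebra of class `n + 1` on two generators is the concrete model. -/
theorem nonempty_equiv_model (n : ℕ) :
    Nonempty (MetabelianModel K n ≃ₗ⁅K⁆ FreeMetabelianLie K 2 (n + 1)) := by
  let x := proj K 2 (n + 1) (FreeLieAlgebra.of K 0)
  let y := proj K 2 (n + 1) (FreeLieAlgebra.of K 1)
  let φ : MetabelianModel K n →ₗ⁅K⁆ FreeMetabelianLie K 2 (n + 1) :=
    evalHom (lowerCentralSeries_eq_bot K 2 (n + 1)) (derivedSeries_eq_bot K 2 (n + 1)) x y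
  let ψ : FreeMetabelianLie K 2 (n + 1) →ₗ⁅K⁆ MetabelianModel K n :=
    lift (MetabelianModel.lowerCentralSeries_eq_bot K n)
      (MetabelianModel.derivedSeries_eq_bot K n) ![genX, genY]
  refine ⟨LieEquiv.ofBijective φ ⟨evalHom_injective _ _ x y ψ (lift_proj _ _ _ 0)
    (lift_proj _ _ _ 1), fun z => ?_⟩⟩
  -- Surjectivity of `φ`: the surjective `proj` factors through it, as can be checked on the free
  -- generators.
  have h : φ.comp (FreeLieAlgebra.lift K ![genX, genY]) = proj K 2 (n + 1) := by
    apply FreeLieAlgebra.hom_ext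
    intro i
    rw [LieHom.comp_apply, FreeLieAlgebra.lift_of_apply]
    fin_cases i
    · exact evalHom_genX _ _ x y
    · exact evalHom_genY _ _ x y
  obtain ⟨w, rfl⟩ := proj_surjective K 2 (n + 1) z
  exact ⟨_, LieHom.congr_fun h w⟩

end FreeMetabelianLie

end Presentation

theorem theorem5p4 (K : Type*) [Field K] [IsAlgClosed K] [CharZero K] (c : ℕ) (hc : 4 ≤ c) :
    Module.Finite K (FreeMetabelianLie K 2 c) ∧
    (lieIndex K (FreeMetabelianLie K 2 c) : ℚ) =
      (Module.finrank K (FreeMetabelianLie K 2 c) : ℚ) - 4 ∧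
    (lieIndex K (FreeMetabelianLie K 2 c) : ℚ) =
      2 * (lieAlpha K (FreeMetabelianLie K 2 c) : ℚ) -
        (Module.finrank K (FreeMetabelianLie K 2 c) : ℚ) ∧
    (lieIndex K (FreeMetabelianLie K 2 c) : ℚ) = ((c : ℚ) ^ 2 - (c : ℚ) - 4) / 2 := by
  -- Class `c` corresponds to truncation at degree `c - 1`, so `4 ≤ c` becomes `3 ≤ n`.
  obtain ⟨n, rfl⟩ : ∃ n, c = n + 1 := ⟨c - 1, by omega⟩
  obtain ⟨e⟩ := FreeMetabelianLie.nonempty_equiv_model K n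
  obtain ⟨h1, h2⟩ := MetabelianModel.lieIndex_lieAlpha K (n := n) (by omega)
  have h3 := MetabelianModel.two_mul_finrank K n
  rw [← lieIndex_congr e, ← lieAlpha_congr e, ← e.toLinearEquiv.finrank_eq]
  replace h1 := congrArg (Nat.cast : ℕ → ℚ) h1
  replace h2 := congrArg (Nat.cast : ℕ → ℚ) h2
  replace h3 := congrArg (Nat.cast : ℕ → ℚ) h3
  push_cast at h1 h2 h3 ⊢
  exact ⟨Module.Finite.equiv e.toLinearEquiv, by linarith, by linarith, by linarith⟩
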